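/- Let $(\Omega,\mathcal F,P)$ be a probability space such that the real Hilbert space $H=L_2(\Omega,\mathcal F,P)$ is separable, and let $\Lambda$ be the set of all sub-$\sigma$-fields of $\mathcal F$ that contain all null sets (sets $s\in\mathcal F$ with $P(s)=0$). Ordered by inclusion, $\Lambda$ is a complete lattice: the infimum of a nonempty subset is its intersection, the supremum of a nonempty subset is the $\sigma$-field generated by its union, the greatest element is $1_\Lambda=\mathcal F$, and the least element $0_\Lambda$ consists of the null sets and their complements. For $x\in\Lambda$ let $Q_x:H\to H$ be the conditional expectation given $x$, that is, the orthogonal projection onto the subspace of $x$-measurable elements of $H$. The strong operator topology on $\Lambda$ is the topology induced by the map $x\mapsto Q_x$ from the strong operator topology on bounded operators on $H$. A noise-type Boolean algebra is a subset $B\subset\Lambda$ that contains $0_\Lambda$ and $1_\Lambda$, is closed under $\wedge$ and $\vee$, is distributive, i.e. $x\wedge(y\vee z)=(x\wedge y)\vee(x\wedge z)$ for all $x,y,z\in B$, and such that each $x\in B$ has a (necessarily unique) complement $x'\in B$, i.e. $x\wedge x'=0_\Lambda$ and $x\vee x'=1_\Lambda$, and the $\sigma$-fields $x,x'$ are independent.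 **Theorem.** Let $B\subset\Lambda$ be a noise-type Boolean algebra and let $$\operatorname{Cl}(B)=\Big\{\liminf_n x_n : x_1,x_2,\dots\in B\Big\},\qquad \liminf_n x_n=\sup_n\inf_k x_{n+k},$$ where suprema and infima are taken in $\Lambda$. Then (a) $\inf_n x_n\in\operatorname{Cl}(B)$ whenever $x_1,x_2,\dots\in\operatorname{Cl}(B)$; (b) $\sup_n x_n\in\operatorname{Cl}(B)$ whenever $x_1,x_2,\dots\in\operatorname{Cl}(B)$ and $x_1\le x_2\le\dots$; (c) $\operatorname{Cl}(B)$ is equal to the topological closure of $B$ in $\Lambda$ with respect to the strong operator topology. -/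

import Mathlib

open MeasureTheory ProbabilityTheory Filter Topology TopologicalSpace
open scoped ENNReal

/-- The set `Λ` of all sub-σ-fields of the σ-field `F` of a probability space `(Ω, F, P)`, where
every σ-field is required to contain all null sets, that is, all `s ∈ F` with `P s = 0`. -/
def SubSigmaField {Ω : Type*} [F : MeasurableSpace Ω] (P : Measure Ω) : Type _ :=
  {m : MeasurableSpace Ω //
    m ≤ F ∧ ∀ s : Set Ω, MeasurableSet[F] s → P s = 0 → MeasurableSet[m] s}

namespace SubSigmaField

variable {Ω : Type*} [F : MeasurableSpace Ω] {P : Measure Ω}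

/-- The partial order of `Λ` is inclusion of σ-fields. -/
instance instPartialOrder : PartialOrder (SubSigmaField P) :=
  inferInstanceAs (PartialOrder {m : MeasurableSpace Ω //
    m ≤ F ∧ ∀ s : Set Ω, MeasurableSet[F] s → P s = 0 → MeasurableSet[m] s})

/-- `x ∧ y = x ∩ y`. -/
instance instMin : Min (SubSigmaField P) where
  min x y := ⟨x.1 ⊓ y.1, inf_le_left.trans x.2.1, fun s hs h0 =>
    MeasurableSpace.measurableSet_inf.2 ⟨x.2.2 s hs h0, y.2.2 s hs h0⟩⟩

/-- `x ∨ y = σ(x, y)`, the least σ-field containing `x` and `y`. -/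
instance instMax : Max (SubSigmaField P) where
  max x y := ⟨x.1 ⊔ y.1, sup_le x.2.1 y.2.1, fun s hs h0 =>
    (le_sup_left : x.1 ≤ x.1 ⊔ y.1) s (x.2.2 s hs h0)⟩

/-- The greatest element of `Λ` is `F`. -/
instance instTop : Top (SubSigmaField P) where
  top := ⟨F, le_rfl, fun _ hs _ => hs⟩

/-- The smallest element of `Λ` is the trivial σ-field, generated by the null sets (it consists of
the null sets and their complements, see `measurableSet_bot_iff`). -/
instance instBot : Bot (SubSigmaField P) where
  bot := ⟨MeasurableSpace.generateFrom {s | MeasurableSet[F] s ∧ P s = 0},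
    MeasurableSpace.generateFrom_le fun _ h => h.1,
    fun _ hs h0 => MeasurableSpace.measurableSet_generateFrom ⟨hs, h0⟩⟩

/-- The infimum of a set `X` is the intersection of its elements (`F` if `X` is empty). -/
instance instInfSet : InfSet (SubSigmaField P) where
  sInf X := ⟨F ⊓ sInf (Subtype.val '' X), inf_le_left, fun s hs h0 =>
    MeasurableSpace.measurableSet_inf.2 ⟨hs, MeasurableSpace.measurableSet_sInf.2 (by
      rintro _ ⟨x, -, rfl⟩
      exact x.2.2 s hs h0)⟩⟩

/-- The supremum of a set `X` is the σ-field generated by the union of its elements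
and the null sets (the latter are superfluous unless `X` is empty). -/
instance instSupSet : SupSet (SubSigmaField P) where
  sSup X := ⟨(⊥ : SubSigmaField P).1 ⊔ sSup (Subtype.val '' X),
    sup_le (⊥ : SubSigmaField P).2.1 (sSup_le (by rintro _ ⟨x, -, rfl⟩; exact x.2.1)),
    fun s hs h0 =>
      (le_sup_left : (⊥ : SubSigmaField P).1 ≤ _) s ((⊥ : SubSigmaField P).2.2 s hs h0)⟩

/-- `Λ` is a complete lattice. -/
instance instCompleteLattice : CompleteLattice (SubSigmaField P) where
  toPartialOrder := instPartialOrder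
  sup := max
  inf := min
  top := ⊤
  bot := ⊥
  sSup := sSup
  sInf := sInf
  le_sup_left x y := (le_sup_left : x.1 ≤ x.1 ⊔ y.1)
  le_sup_right x y := (le_sup_right : y.1 ≤ x.1 ⊔ y.1)
  sup_le x y z hx hy := (sup_le hx hy : x.1 ⊔ y.1 ≤ z.1)
  inf_le_left x y := (inf_le_left : x.1 ⊓ y.1 ≤ x.1)
  inf_le_right x y := (inf_le_right : x.1 ⊓ y.1 ≤ y.1)
  le_inf x y z hx hy := (le_inf hx hy : x.1 ≤ y.1 ⊓ z.1)
  le_top x := x.2.1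
  bot_le x := MeasurableSpace.generateFrom_le fun s hs => x.2.2 s hs.1 hs.2
  isLUB_sSup X := by
    refine ⟨fun x hx => ?_, fun y hy => ?_⟩
    · exact (le_sSup (Set.mem_image_of_mem _ hx)).trans
        (le_sup_right : _ ≤ (⊥ : SubSigmaField P).1 ⊔ sSup (Subtype.val '' X))
    · refine (sup_le (MeasurableSpace.generateFrom_le fun s hs => y.2.2 s hs.1 hs.2)
        (sSup_le ?_) : (⊥ : SubSigmaField P).1 ⊔ sSup (Subtype.val '' X) ≤ y.1)
      rintro _ ⟨x, hx, rfl⟩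
      exact hy hx
  isGLB_sInf X := by
    refine ⟨fun x hx => ?_, fun y hy => ?_⟩
    · exact (inf_le_right : F ⊓ sInf (Subtype.val '' X) ≤ _).trans
        (sInf_le (Set.mem_image_of_mem _ hx))
    · refine (le_inf y.2.1 (le_sInf ?_) : y.1 ≤ F ⊓ sInf (Subtype.val '' X))
      rintro _ ⟨x, hx, rfl⟩
      exact hy hx

theorem measurableSet_bot_iff [IsProbabilityMeasure P] (s : Set Ω) :
    MeasurableSet[(⊥ : SubSigmaField P).1] s ↔ MeasurableSet[F] s ∧ (P s = 0 ∨ P sᶜ = 0) := by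
  constructor
  · intro h
    refine ⟨(⊥ : SubSigmaField P).2.1 s h, ?_⟩
    induction s, h using MeasurableSpace.generateFrom_induction with
    | hC t ht _ => exact Or.inl ht.2
    | empty => simp
    | compl t _ ih => simpa [or_comm] using ih
    | iUnion f _ ih =>
      by_cases h : ∀ n, P (f n) = 0
      · exact Or.inl (measure_iUnion_null h)
      · push Not at h
        obtain ⟨n, hn⟩ := h
        exact Or.inr (measure_mono_null (Set.compl_subset_compl.2 (Set.subset_iUnion f n))
          ((ih n).resolve_left hn))
  · rintro ⟨hs, h | h⟩
    · exact (⊥ : SubSigmaField P).2.2 s hs h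
    · exact MeasurableSet.of_compl ((⊥ : SubSigmaField P).2.2 _ hs.compl h)

/-- The operator `Q_x` of conditional expectation on `H = L₂(Ω, F, P)` (real scalars): the
orthogonal projection onto the subspace `H_x` of all `x`-measurable elements of `H`. -/
noncomputable def condExpOp (x : SubSigmaField P) : Lp ℝ 2 P →L[ℝ] Lp ℝ 2 P :=
  (lpMeas ℝ ℝ x.1 2 P).subtypeL ∘L condExpL2 ℝ ℝ x.2.1

/-- The strong operator topology on `Λ`: the topology induced by `x ↦ Q_x` from the strong operator
topology (that is, the topology of pointwise convergence) on bounded operators on `H`. -/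
noncomputable instance instTopologicalSpace : TopologicalSpace (SubSigmaField P) :=
  TopologicalSpace.induced
    (fun x => ContinuousLinearMap.toPointwiseConvergenceCLM ℝ (RingHom.id ℝ) (Lp ℝ 2 P) (Lp ℝ 2 P)
      (condExpOp x)) inferInstance

/-- The set of lower limits `liminf xₙ = supₙ infₖ xₙ₊ₖ` of all sequences of elements of `B`. -/
def lowerLimits (B : Set (SubSigmaField P)) : Set (SubSigmaField P) :=
  {z | ∃ x : ℕ → SubSigmaField P, (∀ n, x n ∈ B) ∧ z = ⨆ n, ⨅ k, x (n + k)}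

/-- A noise-type Boolean algebra: a distributive sublattice of `Λ` containing `0` and `1`, in which
every element `x` has a complement `y` (unique, by distributivity), and the σ-fields `x`, `y` are
independent. -/
structure IsNoiseTypeBooleanAlgebra (B : Set (SubSigmaField P)) : Prop where
  inf_mem : ∀ x ∈ B, ∀ y ∈ B, x ⊓ y ∈ B
  sup_mem : ∀ x ∈ B, ∀ y ∈ B, x ⊔ y ∈ B
  distrib : ∀ x ∈ B, ∀ y ∈ B, ∀ z ∈ B, x ⊓ (y ⊔ z) = (x ⊓ y) ⊔ (x ⊓ z)
  bot_mem : ⊥ ∈ B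
  top_mem : ⊤ ∈ B
  exists_compl : ∀ x ∈ B, ∃ y ∈ B, x ⊓ y = ⊥ ∧ x ⊔ y = ⊤ ∧ Indep x.1 y.1 P

end SubSigmaField

/-! Everything is read off the projections `condExpOp x`. In `B`, distributivity and complements
split `x` as `(x ⊓ y) ⊔ (x ⊓ y')` with `y'` independent of `y`, which forces Q_x Q_y = Q_{x ∧ y}
(`condExpOp_condExpOp`). Products of contractions are jointly strongly continuous, so this relation
and closure under meets pass to `closure B`. Monotone sequences converge strongly to their supremum
or infimum, so `closure B` is stable under the operations in (a), (b) and in lower limits.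

Conversely, let `x` be in the closure. The product formula telescopes to ‖f - Q_{inf x_k} f‖ ≤ ∑ ‖f
- Q_{x_k} f‖. Choosing `u k` in `B` that approximates `x` within 2^{-k} on more and more vectors of
a dense sequence therefore keeps the tail infima close to `x`, and the lower limit of `u` is `x`.
Parts (a) and (b) then follow from (c). -/

namespace SubSigmaField

variable {Ω : Type*} [F : MeasurableSpace Ω] {P : Measure Ω}

/-! ### The subspace of measurable elements and its orthogonal projection -/

/-- The closed subspace of all `x`-measurable elements of `L₂`. -/
noncomputable def measSubspace (x : SubSigmaField P) : Submodule ℝ (Lp ℝ 2 P) :=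
  lpMeas ℝ ℝ x.1 2 P

instance completeSpace_measSubspace (x : SubSigmaField P) : CompleteSpace x.measSubspace :=
  haveI : Fact (x.1 ≤ F) := ⟨x.2.1⟩
  inferInstanceAs (CompleteSpace (lpMeas ℝ ℝ x.1 2 P))

theorem condExpOp_eq_starProjection (x : SubSigmaField P) :
    condExpOp x = x.measSubspace.starProjection := rfl

theorem mem_measSubspace_iff {x : SubSigmaField P} {f : Lp ℝ 2 P} :
    f ∈ x.measSubspace ↔ AEStronglyMeasurable[x.1] f P :=
  mem_lpMeas_iff_aestronglyMeasurable

theorem isClosed_measSubspace (x : SubSigmaField P) :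
    IsClosed (x.measSubspace : Set (Lp ℝ 2 P)) :=
  (completeSpace_coe_iff_isComplete.1 x.completeSpace_measSubspace).isClosed

theorem condExpOp_mem (x : SubSigmaField P) (f : Lp ℝ 2 P) : condExpOp x f ∈ x.measSubspace :=
  Submodule.starProjection_apply_mem x.measSubspace f

theorem condExpOp_eq_self_iff {x : SubSigmaField P} {f : Lp ℝ 2 P} :
    condExpOp x f = f ↔ f ∈ x.measSubspace := by
  rw [condExpOp_eq_starProjection, Submodule.starProjection_eq_self_iff]

theorem norm_condExpOp_apply_le (x : SubSigmaField P) (f : Lp ℝ 2 P) : ‖condExpOp x f‖ ≤ ‖f‖ :=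
  Submodule.norm_starProjection_apply_le x.measSubspace f

theorem norm_sub_condExpOp_le (x : SubSigmaField P) (f : Lp ℝ 2 P) {g : Lp ℝ 2 P}
    (hg : g ∈ x.measSubspace) : ‖f - condExpOp x f‖ ≤ ‖f - g‖ := by
  rw [condExpOp_eq_starProjection, Submodule.starProjection_minimal]
  exact ciInf_le ⟨0, by rintro _ ⟨y, rfl⟩; exact norm_nonneg _⟩ (⟨g, hg⟩ : x.measSubspace)

theorem measSubspace_mono {x y : SubSigmaField P} (h : x ≤ y) :
    x.measSubspace ≤ y.measSubspace := fun _ hf =>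
  mem_measSubspace_iff.2 ((mem_measSubspace_iff.1 hf).mono h)

theorem condExpOp_condExpOp_of_le {x y : SubSigmaField P} (h : x ≤ y) (f : Lp ℝ 2 P) :
    condExpOp x (condExpOp y f) = condExpOp x f :=
  congrArg (fun T : Lp ℝ 2 P →L[ℝ] Lp ℝ 2 P => T f)
    (Submodule.starProjection_comp_starProjection_of_le (measSubspace_mono h))

/-- A random variable that coincides almost everywhere with an `x`-measurable one is
`x`-measurable. -/
theorem measurable_of_aestronglyMeasurable {x : SubSigmaField P} {f : Ω → ℝ} (hf : Measurable f)
    (hx : AEStronglyMeasurable[x.1] f P) : Measurable[x.1] f := by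
  obtain ⟨g, hg, hfg⟩ := hx
  intro U hU
  have hgU : MeasurableSet[x.1] (g ⁻¹' U) := hg.measurable hU
  have hae : f ⁻¹' U =ᵐ[P] g ⁻¹' U := hfg.preimage U
  have h1 : MeasurableSet[x.1] (f ⁻¹' U \ g ⁻¹' U) :=
    x.2.2 _ ((hf hU).diff (x.2.1 _ hgU)) (ae_le_set.1 hae.le)
  have h2 : MeasurableSet[x.1] (g ⁻¹' U \ f ⁻¹' U) :=
    x.2.2 _ ((x.2.1 _ hgU).diff (hf hU)) (ae_le_set.1 hae.symm.le)
  have : f ⁻¹' U = (g ⁻¹' U \ (g ⁻¹' U \ f ⁻¹' U)) ∪ (f ⁻¹' U \ g ⁻¹' U) := by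
    ext ω; simp only [Set.mem_union, Set.mem_sdiff]; tauto
  rw [this]
  exact (hgU.diff h2).union h1

theorem measSubspace_iInf {ι : Sort*} (x : ι → SubSigmaField P) :
    (⨅ i, x i).measSubspace = ⨅ i, (x i).measSubspace := by
  refine le_antisymm (le_iInf fun i => measSubspace_mono (iInf_le x i)) fun f hf => ?_
  rw [Submodule.mem_iInf] at hf
  -- One fixed representative is measurable for every `x i`, since each contains all null sets;
  -- hence `ι` need not be countable.
  have hfm := (Lp.stronglyMeasurable f).measurable
  have hm : Measurable[(⨅ i, x i).1] f := fun U hU => by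
    refine MeasurableSpace.measurableSet_inf.2 ⟨hfm hU, MeasurableSpace.measurableSet_sInf.2 ?_⟩
    rintro _ ⟨_, ⟨i, rfl⟩, rfl⟩
    exact measurable_of_aestronglyMeasurable hfm (mem_measSubspace_iff.1 (hf i)) hU
  exact mem_measSubspace_iff.2 hm.stronglyMeasurable.aestronglyMeasurable

theorem measSubspace_inf (x y : SubSigmaField P) :
    (x ⊓ y).measSubspace = x.measSubspace ⊓ y.measSubspace := by
  rw [inf_eq_iInf, measSubspace_iInf, inf_eq_iInf]
  exact iInf_congr (Bool.rec rfl rfl)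

theorem le_of_measSubspace_le [IsFiniteMeasure P] {x y : SubSigmaField P}
    (h : x.measSubspace ≤ y.measSubspace) : x ≤ y := by
  intro s hs
  have hsF := x.2.1 _ hs
  have h1 : indicatorConstLp 2 hsF (measure_ne_top P s) (1 : ℝ) ∈ y.measSubspace :=
    h (mem_lpMeas_indicatorConstLp x.2.1 hs (measure_ne_top P s))
  have h2 : AEStronglyMeasurable[y.1] (s.indicator fun _ => (1 : ℝ)) P :=
    (mem_measSubspace_iff.1 h1).congr indicatorConstLp_coeFn
  have h3 := measurable_of_aestronglyMeasurable (measurable_const.indicator hsF) h2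
  have h4 := h3 (measurableSet_singleton (1 : ℝ))
  convert h4 using 1
  ext ω
  by_cases hω : ω ∈ s <;> simp [hω]

theorem tendsto_nhds_iff {ι : Type*} {l : Filter ι} {u : ι → SubSigmaField P}
    {x : SubSigmaField P} :
    Tendsto u l (𝓝 x) ↔ ∀ f, Tendsto (fun i => condExpOp (u i) f) l (𝓝 (condExpOp x f)) := by
  rw [nhds_induced, tendsto_comap_iff, PointwiseConvergenceCLM.tendsto_iff_forall_tendsto]
  rfl

/-! ### Vanishing of conditional expectations, tested on a π-system -/

theorem setIntegral_eq_zero_of_generateFrom {π : Set (Set Ω)} (hπ : IsPiSystem π)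
    (hmeas : ∀ s ∈ π, MeasurableSet s) (huniv : Set.univ ∈ π) {h : Ω → ℝ} (hh : Integrable h P)
    (hzero : ∀ s ∈ π, ∫ ω in s, h ω ∂P = 0) (s : Set Ω)
    (hs : MeasurableSet[MeasurableSpace.generateFrom π] s) : ∫ ω in s, h ω ∂P = 0 := by
  have hle : MeasurableSpace.generateFrom π ≤ F := MeasurableSpace.generateFrom_le hmeas
  induction s, hs using MeasurableSpace.induction_on_inter (m := .generateFrom π) rfl hπ with
  | empty => simp
  | basic t ht => exact hzero t ht
  | compl t ht ih =>
    have h1 := integral_add_compl (hle t ht) hh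
    have h2 := hzero _ huniv
    rw [Measure.restrict_univ] at h2
    rwa [ih, h2, zero_add] at h1
  | iUnion f hd hf ih =>
    have h1 := hasSum_integral_iUnion (fun i => hle _ (hf i)) hd hh.integrableOn
    simp only [ih] at h1
    exact h1.unique hasSum_zero

theorem condExpOp_eq_zero_of_generateFrom [IsFiniteMeasure P] {x : SubSigmaField P}
    {π : Set (Set Ω)} (hπ : IsPiSystem π) (hmeas : ∀ s ∈ π, MeasurableSet s)
    (huniv : Set.univ ∈ π) (hx : x.1 ≤ MeasurableSpace.generateFrom π) {h : Lp ℝ 2 P}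
    (hzero : ∀ s ∈ π, ∫ ω in s, h ω ∂P = 0) : condExpOp x h = 0 := by
  have hint : ∀ g : Lp ℝ 2 P, Integrable g P := fun g => (Lp.memLp g).integrable one_le_two
  refine (Lp.eq_zero_iff_ae_eq_zero).2 (Lp.ae_eq_zero_of_forall_setIntegral_eq_zero' ℝ x.2.1 _
    two_ne_zero ENNReal.ofNat_ne_top (fun s _ _ => (hint _).integrableOn) (fun s hs _ => ?_)
    (mem_measSubspace_iff.1 (condExpOp_mem x h)))
  have hsF := x.2.1 _ hs
  have hmem : indicatorConstLp 2 hsF (measure_ne_top P s) (1 : ℝ) ∈ x.measSubspace :=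
    mem_lpMeas_indicatorConstLp x.2.1 hs (measure_ne_top P s)
  -- The projection is self-adjoint and fixes the indicator of `s`, so it can be dropped from the
  -- integral over `s`.
  rw [← L2.inner_indicatorConstLp_one (𝕜 := ℝ) hsF (measure_ne_top P s),
    condExpOp_eq_starProjection, ← Submodule.inner_starProjection_left_eq_right,
    Submodule.starProjection_eq_self_iff.2 hmem, L2.inner_indicatorConstLp_one]
  exact setIntegral_eq_zero_of_generateFrom hπ hmeas huniv (hint h) hzero s (hx s hs)

theorem setIntegral_eq_zero_of_condExpOp_eq_zero [IsFiniteMeasure P] {x : SubSigmaField P}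
    {h : Lp ℝ 2 P} (hh : condExpOp x h = 0) {s : Set Ω} (hs : MeasurableSet[x.1] s) :
    ∫ ω in s, h ω ∂P = 0 := by
  have hmem : indicatorConstLp 2 (x.2.1 _ hs) (measure_ne_top P s) (1 : ℝ) ∈ x.measSubspace :=
    mem_lpMeas_indicatorConstLp x.2.1 hs (measure_ne_top P s)
  rw [← L2.inner_indicatorConstLp_one (𝕜 := ℝ) (x.2.1 _ hs) (measure_ne_top P s)]
  exact (Submodule.starProjection_apply_eq_zero_iff x.measSubspace).1 hh _ hmem

/-! ### Monotone sequences converge -/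

/-- The component of `f` orthogonal to all `(x n).measSubspace` has zero integral over every set of
the π-system ⋃ x_n. This system generates the supremum, so the component, itself measurable for the
supremum, vanishes. -/
theorem measSubspace_iSup_of_monotone [IsFiniteMeasure P] {x : ℕ → SubSigmaField P}
    (hx : Monotone x) :
    (⨆ n, x n).measSubspace = (⨆ n, (x n).measSubspace).topologicalClosure := by
  have hle : (⨆ n, (x n).measSubspace).topologicalClosure ≤ (⨆ n, x n).measSubspace :=
    Submodule.topologicalClosure_minimal _ (iSup_le fun n => measSubspace_mono (le_iSup x n))
      (isClosed_measSubspace _)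
  refine le_antisymm (fun f hf => ?_) hle
  set K := (⨆ n, (x n).measSubspace).topologicalClosure
  have hxK : ∀ n, (x n).measSubspace ≤ K := fun n =>
    (le_iSup (fun n => (x n).measSubspace) n).trans (Submodule.le_topologicalClosure _)
  set h := f - K.starProjection f with hdef
  have hh : h ∈ (⨆ n, x n).measSubspace :=
    Submodule.sub_mem _ hf (hle (Submodule.starProjection_apply_mem _ _))
  have hK : h ∈ Kᗮ := Submodule.sub_starProjection_mem_orthogonal f
  have h0 : condExpOp (⨆ n, x n) h = 0 := by
    refine condExpOp_eq_zero_of_generateFrom (π := ⋃ n, {s | MeasurableSet[(x n).1] s})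
      (isPiSystem_iUnion_of_monotone _ (fun n => @MeasurableSpace.isPiSystem_measurableSet _ (x n).1)
        fun m n hmn s hs => hx hmn s hs) ?_ (Set.mem_iUnion.2 ⟨0, MeasurableSet.univ⟩) ?_ ?_
    · intro s hs
      obtain ⟨n, hn⟩ := Set.mem_iUnion.1 hs
      exact (x n).2.1 _ hn
    · have hn : ∀ n, (x n).1 ≤ MeasurableSpace.generateFrom (⋃ n, {s | MeasurableSet[(x n).1] s}) :=
        fun n s hs => MeasurableSpace.measurableSet_generateFrom (Set.mem_iUnion.2 ⟨n, hs⟩)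
      refine sup_le (le_trans (bot_le : ⊥ ≤ x 0) (hn 0)) (sSup_le ?_)
      rintro _ ⟨_, ⟨n, rfl⟩, rfl⟩
      exact hn n
    · intro s hs
      obtain ⟨n, hn⟩ := Set.mem_iUnion.1 hs
      exact setIntegral_eq_zero_of_condExpOp_eq_zero
        ((Submodule.starProjection_apply_eq_zero_iff (x n).measSubspace).2
          (Submodule.orthogonal_le (hxK n) hK)) hn
  rw [condExpOp_eq_self_iff.2 hh, hdef, sub_eq_zero] at h0
  exact Submodule.starProjection_eq_self_iff.1 h0.symm

theorem tendsto_iSup_of_monotone [IsFiniteMeasure P] {x : ℕ → SubSigmaField P}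
    (hx : Monotone x) : Tendsto x atTop (𝓝 (⨆ n, x n)) := by
  refine tendsto_nhds_iff.2 fun f => ?_
  have := Submodule.starProjection_tendsto_closure_iSup (fun n => (x n).measSubspace)
    (fun m n hmn => measSubspace_mono (hx hmn)) f
  simp only [condExpOp_eq_starProjection]
  convert this using 3
  simp only [measSubspace_iSup_of_monotone hx]

/-- Pure Hilbert space geometry: the orthogonal complements increase, and the closure of their union
is the complement of the intersection. -/
theorem tendsto_iInf_of_antitone {x : ℕ → SubSigmaField P}
    (hx : Antitone x) : Tendsto x atTop (𝓝 (⨅ n, x n)) := by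
  refine tendsto_nhds_iff.2 fun f => ?_
  have key := Submodule.starProjection_tendsto_closure_iSup (fun n => ((x n).measSubspace)ᗮ)
    (fun m n hmn => Submodule.orthogonal_le (measSubspace_mono (hx hmn))) f
  have hperp : (⨆ n, ((x n).measSubspace)ᗮ).topologicalClosure = ((⨅ n, x n).measSubspace)ᗮ := by
    rw [← Submodule.orthogonal_orthogonal_eq_closure, ← Submodule.iInf_orthogonal,
      measSubspace_iInf]
    simp only [Submodule.orthogonal_orthogonal]
  simp only [hperp, Submodule.starProjection_orthogonal, sub_apply,
    ContinuousLinearMap.id_apply] at key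
  simpa [condExpOp_eq_starProjection] using key.const_sub f

/-! ### Commutation in a noise-type Boolean algebra -/

theorem setIntegral_eq_measureReal_mul_of_indep [IsProbabilityMeasure P] {y b : SubSigmaField P}
    (hind : Indep y.1 b.1 P) {g : Ω → ℝ} (hg : StronglyMeasurable[y.1] g) (hgi : Integrable g P)
    {s : Set Ω} (hs : MeasurableSet[b.1] s) : ∫ ω in s, g ω ∂P = P.real s * ∫ ω, g ω ∂P := by
  rw [← setIntegral_condExp b.2.1 hgi hs,
    setIntegral_congr_ae (g := fun _ => ∫ ω, g ω ∂P) (b.2.1 _ hs)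
      ((condExp_indep_eq y.2.1 b.2.1 hg hind).mono fun _ h _ => h)]
  simp

/-- The sets A ∩ B with A in `a`, B in `b` form a π-system generating `a ⊔ b`. As h·1_A is
`y`-measurable, independence gives ∫_{A ∩ B} h = P(B) ∫_A h = 0. -/
theorem condExpOp_sup_eq_zero_of_indep [IsProbabilityMeasure P] {a b y : SubSigmaField P}
    (hay : a ≤ y) (hind : Indep y.1 b.1 P) {h : Lp ℝ 2 P} (hy : h ∈ y.measSubspace)
    (ha : condExpOp a h = 0) : condExpOp (a ⊔ b) h = 0 := by
  refine condExpOp_eq_zero_of_generateFrom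
    (π := {s | ∃ A B, MeasurableSet[a.1] A ∧ MeasurableSet[b.1] B ∧ s = A ∩ B}) ?_ ?_
    ⟨_, _, MeasurableSet.univ, MeasurableSet.univ, (Set.univ_inter _).symm⟩ ?_ ?_
  · rintro _ ⟨A, B, hA, hB, rfl⟩ _ ⟨A', B', hA', hB', rfl⟩ -
    exact ⟨_, _, hA.inter hA', hB.inter hB', Set.inter_inter_inter_comm _ _ _ _⟩
  · rintro _ ⟨A, B, hA, hB, rfl⟩
    exact (a.2.1 _ hA).inter (b.2.1 _ hB)
  · refine sup_le (fun s hs => ?_) (fun s hs => ?_)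
    · exact MeasurableSpace.measurableSet_generateFrom
        ⟨_, _, hs, MeasurableSet.univ, (Set.inter_univ _).symm⟩
    · exact MeasurableSpace.measurableSet_generateFrom
        ⟨_, _, MeasurableSet.univ, hs, (Set.univ_inter _).symm⟩
  · rintro _ ⟨A, B, hA, hB, rfl⟩
    obtain ⟨g, hg, hhg⟩ := mem_measSubspace_iff.1 hy
    have hgi : Integrable g P := ((Lp.memLp h).integrable one_le_two).congr hhg
    have hAF := a.2.1 _ hA
    have h0 : ∫ ω in A, g ω ∂P = 0 := by
      rw [← setIntegral_eq_zero_of_condExpOp_eq_zero ha hA]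
      exact integral_congr_ae (ae_restrict_of_ae hhg.symm)
    have h1 := setIntegral_eq_measureReal_mul_of_indep hind (hg.indicator (hay _ hA))
      (hgi.indicator hAF) hB
    rw [setIntegral_indicator hAF, integral_indicator hAF, h0, mul_zero, Set.inter_comm] at h1
    rw [← h1]
    exact integral_congr_ae (ae_restrict_of_ae hhg)

theorem condExpOp_sup_of_indep [IsProbabilityMeasure P] {a b y : SubSigmaField P}
    (hay : a ≤ y) (hind : Indep y.1 b.1 P) (f : Lp ℝ 2 P) :
    condExpOp (a ⊔ b) (condExpOp y f) = condExpOp a f := by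
  have ha : condExpOp a (condExpOp y f - condExpOp a f) = 0 := by
    rw [map_sub, condExpOp_condExpOp_of_le hay, condExpOp_condExpOp_of_le le_rfl, sub_self]
  have h := condExpOp_sup_eq_zero_of_indep hay hind
    (Submodule.sub_mem _ (condExpOp_mem y f) (measSubspace_mono hay (condExpOp_mem a f))) ha
  rw [map_sub, sub_eq_zero] at h
  rw [h]
  exact condExpOp_eq_self_iff.2 (measSubspace_mono le_sup_left (condExpOp_mem a f))

theorem IsNoiseTypeBooleanAlgebra.condExpOp_condExpOp [IsProbabilityMeasure P]
    {B : Set (SubSigmaField P)} (hB : IsNoiseTypeBooleanAlgebra B) {x y : SubSigmaField P}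
    (hx : x ∈ B) (hy : y ∈ B) (f : Lp ℝ 2 P) :
    condExpOp x (condExpOp y f) = condExpOp (x ⊓ y) f := by
  obtain ⟨y', hy', -, hsup, hind⟩ := hB.exists_compl y hy
  -- The only use of distributivity: `x` becomes a part inside `y` joined with a part independent of
  -- `y`.
  have hx' : x = (x ⊓ y) ⊔ (x ⊓ y') := by
    rw [← hB.distrib x hx y hy y' hy', hsup]; exact (inf_top_eq x).symm
  have h := condExpOp_sup_of_indep (inf_le_right : x ⊓ y ≤ y)
    (indep_of_indep_of_le_right hind (inf_le_right : x ⊓ y' ≤ y')) f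
  rwa [← hx'] at h

/-- If two conditional expectations commute, then their product is the conditional expectation
given the intersection of the σ-fields. -/
theorem condExpOp_inf_of_commute {x y : SubSigmaField P} {f : Lp ℝ 2 P}
    (h : condExpOp x (condExpOp y f) = condExpOp y (condExpOp x f)) :
    condExpOp x (condExpOp y f) = condExpOp (x ⊓ y) f := by
  have hmem : condExpOp x (condExpOp y f) ∈ (x ⊓ y).measSubspace := by
    rw [measSubspace_inf]
    exact ⟨condExpOp_mem _ _, h ▸ condExpOp_mem _ _⟩
  rw [← condExpOp_eq_self_iff.2 hmem, condExpOp_condExpOp_of_le inf_le_left,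
    condExpOp_condExpOp_of_le inf_le_right]

theorem tendsto_condExpOp_condExpOp {ι : Type*} {l : Filter ι} {u v : ι → SubSigmaField P}
    {x y : SubSigmaField P} (hu : Tendsto u l (𝓝 x)) (hv : Tendsto v l (𝓝 y)) (f : Lp ℝ 2 P) :
    Tendsto (fun i => condExpOp (u i) (condExpOp (v i) f)) l
      (𝓝 (condExpOp x (condExpOp y f))) := by
  have h1 := tendsto_nhds_iff.1 hu (condExpOp y f)
  have h2 : Tendsto (fun i => condExpOp (u i) (condExpOp (v i) f - condExpOp y f)) l (𝓝 0) := by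
    refine squeeze_zero_norm (fun i => norm_condExpOp_apply_le _ _) ?_
    exact tendsto_iff_norm_sub_tendsto_zero.1 (tendsto_nhds_iff.1 hv f)
  simpa using h2.add h1

/-! ### Stability of the closure under meets and lower limits -/

namespace IsNoiseTypeBooleanAlgebra

variable {B : Set (SubSigmaField P)}

theorem inf_mem_closure [IsProbabilityMeasure P] (hB : IsNoiseTypeBooleanAlgebra B)
    {x y : SubSigmaField P} (hx : x ∈ closure B) (hy : y ∈ closure B) : x ⊓ y ∈ closure B := by
  rw [mem_closure_iff_nhdsWithin_neBot] at hx hy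
  -- Along the product filter both factors stay in `B`, where the projections commute; the limits
  -- then commute too.
  set l := 𝓝[B] x ×ˢ 𝓝[B] y
  have hu : Tendsto Prod.fst l (𝓝 x) := tendsto_fst.mono_right nhdsWithin_le_nhds
  have hv : Tendsto Prod.snd l (𝓝 y) := tendsto_snd.mono_right nhdsWithin_le_nhds
  have hmem : ∀ᶠ p in l, p.1 ∈ B ∧ p.2 ∈ B :=
    (tendsto_fst.eventually self_mem_nhdsWithin).and (tendsto_snd.eventually self_mem_nhdsWithin)
  have hcomm : ∀ f, condExpOp x (condExpOp y f) = condExpOp y (condExpOp x f) := fun f =>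
    tendsto_nhds_unique_of_eventuallyEq (tendsto_condExpOp_condExpOp hu hv f)
      (tendsto_condExpOp_condExpOp hv hu f) <| hmem.mono fun p hp => by
        simp only [hB.condExpOp_condExpOp hp.1 hp.2, hB.condExpOp_condExpOp hp.2 hp.1, inf_comm p.1]
  have hlim : Tendsto (fun p : SubSigmaField P × SubSigmaField P => p.1 ⊓ p.2) l (𝓝 (x ⊓ y)) := by
    refine tendsto_nhds_iff.2 fun f => ?_
    rw [← condExpOp_inf_of_commute (hcomm f)]
    exact (tendsto_condExpOp_condExpOp hu hv f).congr' <| hmem.mono fun p hp =>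
      hB.condExpOp_condExpOp hp.1 hp.2 f
  exact mem_closure_of_tendsto hlim (hmem.mono fun p hp => hB.inf_mem _ hp.1 _ hp.2)

theorem finset_inf_mem (hB : IsNoiseTypeBooleanAlgebra B) {ι : Type*} {x : ι → SubSigmaField P}
    (hx : ∀ i, x i ∈ B) (s : Finset ι) : s.inf x ∈ B := by
  classical
  induction s using Finset.induction_on with
  | empty => exact hB.top_mem
  | insert a s _ ih => rw [Finset.inf_insert]; exact hB.inf_mem _ (hx a) _ ih

theorem finset_inf_mem_closure [IsProbabilityMeasure P] (hB : IsNoiseTypeBooleanAlgebra B)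
    {ι : Type*} {x : ι → SubSigmaField P} (hx : ∀ i, x i ∈ closure B) (s : Finset ι) :
    s.inf x ∈ closure B := by
  classical
  induction s using Finset.induction_on with
  | empty => exact subset_closure hB.top_mem
  | insert a s _ ih => rw [Finset.inf_insert]; exact hB.inf_mem_closure (hx a) ih

end IsNoiseTypeBooleanAlgebra

theorem tendsto_finset_range_inf (x : ℕ → SubSigmaField P) :
    Tendsto (fun n => (Finset.range n).inf x) atTop (𝓝 (⨅ n, x n)) := by
  have h : ⨅ n, (Finset.range n).inf x = ⨅ n, x n :=
    le_antisymm (le_iInf fun n => (iInf_le _ (n + 1)).trans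
        (Finset.inf_le (Finset.mem_range.2 n.lt_succ_self)))
      (le_iInf fun n => Finset.le_inf fun i _ => iInf_le x i)
  rw [← h]
  exact tendsto_iInf_of_antitone fun m n hmn => Finset.inf_mono (Finset.range_mono hmn)

theorem monotone_iInf_add (x : ℕ → SubSigmaField P) : Monotone fun n => ⨅ k, x (n + k) := by
  intro m n hmn
  refine le_iInf fun k => (iInf_le _ (n - m + k)).trans_eq ?_
  congr 1
  omega

namespace IsNoiseTypeBooleanAlgebra

variable {B : Set (SubSigmaField P)}

theorem iInf_mem_closure [IsProbabilityMeasure P] (hB : IsNoiseTypeBooleanAlgebra B)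
    {x : ℕ → SubSigmaField P} (hx : ∀ n, x n ∈ closure B) : ⨅ n, x n ∈ closure B := by
  rw [← closure_closure]
  exact mem_closure_of_tendsto (tendsto_finset_range_inf x)
    (.of_forall fun n => hB.finset_inf_mem_closure hx _)

theorem lowerLimits_subset_closure [IsProbabilityMeasure P] (hB : IsNoiseTypeBooleanAlgebra B) :
    lowerLimits B ⊆ closure B := by
  rintro _ ⟨x, hx, rfl⟩
  rw [← closure_closure]
  exact mem_closure_of_tendsto (tendsto_iSup_of_monotone (monotone_iInf_add x))
    (.of_forall fun n => hB.iInf_mem_closure fun k => subset_closure (hx _))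

/-- A quantitative bound for the projection to the infimum of a sequence. -/
theorem norm_sub_condExpOp_finset_inf_le [IsProbabilityMeasure P]
    (hB : IsNoiseTypeBooleanAlgebra B) {x : ℕ → SubSigmaField P} (hx : ∀ n, x n ∈ B)
    (f : Lp ℝ 2 P) (m : ℕ) :
    ‖f - condExpOp ((Finset.range m).inf x) f‖ ≤
      ∑ k ∈ Finset.range m, ‖f - condExpOp (x k) f‖ := by
  induction m with
  | zero =>
    have : condExpOp (⊤ : SubSigmaField P) f = f :=
      condExpOp_eq_self_iff.2 (mem_measSubspace_iff.2 (Lp.aestronglyMeasurable f))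
    simp [this]
  | succ m ih =>
    rw [Finset.sum_range_succ, Finset.range_add_one, Finset.inf_insert, inf_comm,
      ← hB.condExpOp_condExpOp (hB.finset_inf_mem hx _) (hx m)]
    set z := (Finset.range m).inf x
    calc ‖f - condExpOp z (condExpOp (x m) f)‖
        -- Telescoping: the second term is controlled because the projection is a contraction.
        = ‖(f - condExpOp z f) + condExpOp z (f - condExpOp (x m) f)‖ := by
          rw [map_sub]; congr 1; abel
      _ ≤ _ := (norm_add_le _ _).trans (add_le_add ih (norm_condExpOp_apply_le _ _))

theorem norm_sub_condExpOp_iInf_le [IsProbabilityMeasure P]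
    (hB : IsNoiseTypeBooleanAlgebra B) {x : ℕ → SubSigmaField P} (hx : ∀ n, x n ∈ B)
    {f : Lp ℝ 2 P} {c : ℝ} (hc : ∀ k, ‖f - condExpOp (x k) f‖ ≤ c * (1 / 2) ^ k) :
    ‖f - condExpOp (⨅ k, x k) f‖ ≤ c * 2 := by
  have hlim := ((tendsto_nhds_iff.1 (tendsto_finset_range_inf x) f).const_sub f).norm
  refine le_of_tendsto hlim (.of_forall fun m => ?_)
  have hc0 : 0 ≤ c := by simpa using (norm_nonneg _).trans (hc 0)
  refine (hB.norm_sub_condExpOp_finset_inf_le hx f m).trans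
    ((Finset.sum_le_sum fun k _ => hc k).trans ?_)
  rw [← Finset.mul_sum]
  exact mul_le_mul_of_nonneg_left (sum_geometric_two_le m) hc0

end IsNoiseTypeBooleanAlgebra

/-! ### Points of the closure are lower limits -/

theorem exists_mem_norm_sub_lt_of_mem_closure {B : Set (SubSigmaField P)} {x : SubSigmaField P}
    (hx : x ∈ closure B) (s : Finset (Lp ℝ 2 P)) {ε : ℝ} (hε : 0 < ε) :
    ∃ y ∈ B, ∀ f ∈ s, ‖condExpOp x f - condExpOp y f‖ < ε := by
  have h : ∀ᶠ y in 𝓝 x, ∀ f ∈ s, ‖condExpOp x f - condExpOp y f‖ < ε := by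
    refine (Finset.eventually_all s).2 fun f _ => ?_
    have := tendsto_nhds_iff.1 (tendsto_id (x := 𝓝 x)) f
    filter_upwards [this.eventually (Metric.ball_mem_nhds _ hε)] with y hy
    rwa [← dist_eq_norm, dist_comm]
  obtain ⟨y, hy, hyB⟩ := mem_closure_iff_nhds.1 hx _ h
  exact ⟨y, hyB, hy⟩

theorem IsNoiseTypeBooleanAlgebra.closure_subset_lowerLimits [IsProbabilityMeasure P]
    [SeparableSpace (Lp ℝ 2 P)] {B : Set (SubSigmaField P)} (hB : IsNoiseTypeBooleanAlgebra B) :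
    closure B ⊆ lowerLimits B := by
  classical
  intro x hx
  set v : ℕ → Lp ℝ 2 P := denseSeq (Lp ℝ 2 P)
  have hv : DenseRange v := denseRange_denseSeq _
  -- Closeness on the `v i` will give liminf ≤ x; closeness on their projections, with summable
  -- errors, gives x ≤ liminf.
  choose u huB hu using fun k : ℕ => exists_mem_norm_sub_lt_of_mem_closure hx
    ((Finset.range (k + 1)).image v ∪ (Finset.range (k + 1)).image fun i => condExpOp x (v i))
    (ε := (1 / 2) ^ k) (by positivity)
  have hu1 : ∀ i k, i ≤ k → ‖condExpOp x (v i) - condExpOp (u k) (v i)‖ < (1 / 2) ^ k :=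
    fun i k hik => hu k _ (Finset.mem_union_left _
      (Finset.mem_image_of_mem _ (Finset.mem_range.2 (Nat.lt_succ_of_le hik))))
  have hu2 : ∀ i k, i ≤ k →
      ‖condExpOp x (v i) - condExpOp (u k) (condExpOp x (v i))‖ < (1 / 2) ^ k := by
    intro i k hik
    have := hu k _ (Finset.mem_union_right _ (Finset.mem_image_of_mem
      (fun i => condExpOp x (v i)) (Finset.mem_range.2 (Nat.lt_succ_of_le hik))))
    rwa [condExpOp_condExpOp_of_le le_rfl] at this
  have hgeom : Tendsto (fun k : ℕ => ((1 : ℝ) / 2) ^ k) atTop (𝓝 0) :=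
    tendsto_pow_atTop_nhds_zero_of_lt_one (by norm_num) (by norm_num)
  set y := ⨆ n, ⨅ k, u (n + k)
  refine ⟨u, huB, le_antisymm ?_ (iSup_le fun n => ?_)⟩
  · have hvy : ∀ i, condExpOp x (v i) ∈ y.measSubspace := by
      intro i
      set f := condExpOp x (v i)
      -- The tail infimum from `n` lies below `y`, so its projection of `f` competes in the distance
      -- from `f` to `y.measSubspace`; the errors sum to at most 2·2^{-n}.
      have hbound : ∀ᶠ n in atTop, ‖f - condExpOp y f‖ ≤ (1 / 2) ^ n * 2 := by
        filter_upwards [eventually_ge_atTop i] with n hn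
        refine (norm_sub_condExpOp_le y f (measSubspace_mono
          (le_iSup (fun n => ⨅ k, u (n + k)) n) (condExpOp_mem (⨅ k, u (n + k)) f))).trans
          (hB.norm_sub_condExpOp_iInf_le (fun k => huB _) fun k => ?_)
        rw [← pow_add]
        exact (hu2 i (n + k) (hn.trans (Nat.le_add_right n k))).le
      have h0 : ‖f - condExpOp y f‖ ≤ 0 := by
        simpa using ge_of_tendsto (hgeom.mul_const 2) hbound
      rw [← condExpOp_eq_self_iff]
      exact (sub_eq_zero.1 (norm_le_zero_iff.1 h0)).symm
    refine le_of_measSubspace_le fun f hf => ?_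
    rw [← condExpOp_eq_self_iff.2 hf]
    exact hv.induction_on (p := fun g => condExpOp x g ∈ y.measSubspace) f
      ((isClosed_measSubspace y).preimage (condExpOp x).continuous) hvy
  · refine le_of_measSubspace_le fun f hf => ?_
    -- An `f` measurable for the tail infimum is fixed by all later `u k`, which act on `v i` almost
    -- as `x` does; letting `v i` approach `f` shows that `x` fixes `f`.
    have hfk : ∀ k, n ≤ k → condExpOp (u k) f = f := fun k hk => condExpOp_eq_self_iff.2
      (measSubspace_mono ((iInf_le _ (k - n)).trans_eq (by congr 1; omega)) hf)
    have hbound : ∀ i, ‖condExpOp x f - f‖ ≤ ‖f - v i‖ * 2 := by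
      intro i
      have : ∀ᶠ k in atTop, ‖condExpOp x f - f‖ ≤ ‖f - v i‖ * 2 + (1 / 2) ^ k := by
        filter_upwards [eventually_ge_atTop (max n i)] with k hk
        have e : condExpOp x f - f = condExpOp x (f - v i)
            + (condExpOp x (v i) - condExpOp (u k) (v i)) - condExpOp (u k) (f - v i) := by
          rw [map_sub, map_sub, hfk k (le_of_max_le_left hk)]; abel
        rw [e]
        have e1 := norm_condExpOp_apply_le x (f - v i)
        have e2 := norm_condExpOp_apply_le (u k) (f - v i)
        have e3 := hu1 i k (le_of_max_le_right hk)
        have e4 := norm_sub_le (condExpOp x (f - v i)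
            + (condExpOp x (v i) - condExpOp (u k) (v i))) (condExpOp (u k) (f - v i))
        have e5 := norm_add_le (condExpOp x (f - v i))
          (condExpOp x (v i) - condExpOp (u k) (v i))
        linarith
      simpa using ge_of_tendsto (hgeom.const_add (‖f - v i‖ * 2)) this
    have h0 : ‖condExpOp x f - f‖ ≤ 0 := by
      refine le_of_forall_pos_le_add fun ε hε => ?_
      obtain ⟨i, hi⟩ := hv.exists_dist_lt f (half_pos hε)
      rw [dist_eq_norm] at hi
      linarith [hbound i]
    exact condExpOp_eq_self_iff.1 (sub_eq_zero.1 (norm_le_zero_iff.1 h0))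

theorem IsNoiseTypeBooleanAlgebra.lowerLimits_eq_closure [IsProbabilityMeasure P]
    [SeparableSpace (Lp ℝ 2 P)] {B : Set (SubSigmaField P)} (hB : IsNoiseTypeBooleanAlgebra B) :
    lowerLimits B = closure B :=
  hB.lowerLimits_subset_closure.antisymm hB.closure_subset_lowerLimits

end SubSigmaField

theorem mainTheorem5 {Ω : Type*} [F : MeasurableSpace Ω] (P : Measure Ω) [IsProbabilityMeasure P]
    [SeparableSpace (Lp ℝ 2 P)] (B : Set (SubSigmaField P))
    (hB : SubSigmaField.IsNoiseTypeBooleanAlgebra B) :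
    (∀ x : ℕ → SubSigmaField P, (∀ n, x n ∈ SubSigmaField.lowerLimits B) →
      iInf x ∈ SubSigmaField.lowerLimits B) ∧
    (∀ x : ℕ → SubSigmaField P, (∀ n, x n ∈ SubSigmaField.lowerLimits B) → Monotone x →
      iSup x ∈ SubSigmaField.lowerLimits B) ∧
    SubSigmaField.lowerLimits B = closure B := by
  rw [hB.lowerLimits_eq_closure]
  refine ⟨fun x hx => hB.iInf_mem_closure hx, fun x hx hmono => ?_, rfl⟩
  exact isClosed_closure.mem_of_tendsto (SubSigmaField.tendsto_iSup_of_monotone hmono)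
    (.of_forall hx)
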